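/- A noncrossing graph on $n$ vertices is a simple graph on the vertex set $\{1,\dots,n\}$ such that, when the vertices are placed in this order around a circle and the edges are drawn as straight chords, no two edges cross; equivalently, there are no $a<b<c<d$ such that both $ac$ and $bd$ are edges. Let $N_n$ be the number of connected noncrossing graphs on $n$ (labelled) vertices. Then for every integer $n\ge 1$, $$N_n=\frac{2^{2n-1}}{n}\binom{\frac32 n-2}{n-1}-\frac{2^{2n-2}}{n}\binom{\frac32 n-\frac32}{n-1},$$ where $\binom{x}{k}=\frac{x(x-1)\cdots(x-k+1)}{k!}$ denotes the generalized binomial coefficient for rational $x$ and integer $k\ge 0$. -/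

import Mathlib

/-- A graph on the vertices `0, 1, …, n - 1`, placed in this order around a circle with edges drawn
as chords, is noncrossing if no two edges cross. The chords `ac` and `bd` cross in their interiors
exactly when, up to naming, their endpoints interleave as `a < b < c < d`. -/
def SimpleGraph.IsNoncrossing {n : ℕ} (G : SimpleGraph (Fin n)) : Prop :=
  ∀ a b c d : Fin n, a < b → b < c → c < d → ¬ (G.Adj a c ∧ G.Adj b d)

/-- The number `N_n` of connected noncrossing graphs on `n` (labelled) vertices. -/
noncomputable def numConnectedNoncrossing (n : ℕ) : ℕ :=
  Nat.card {G : SimpleGraph (Fin n) // G.Connected ∧ G.IsNoncrossing}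

/-! Let C = ∑ N_{m+1} X^m, and let E count in the same way the graphs on 0, …, m+1 that contain the
outer chord from 0 to m+1. Cutting a connected graph at the largest neighbour k of 0 gives a graph
with outer chord 0k and a connected graph from k onwards, so C = 1 + XEC. Deleting the outer chord
leaves either a connected graph without it or two connected graphs on complementary intervals, so
2XE = C - 1 + XC². Eliminating E gives XC³ + C² - 3C + 2 = 0.

With s = 2/C - 1 this becomes s - s³ = 4X, and 2XC = s - s². The coefficients of s² and s yield the
two binomial terms. Both series satisfy second-order linear differential equations, whose
coefficient recurrences step by two; the closed forms satisfy the same recurrences (`coeff_root`,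
`coeff_root_sq`). -/

namespace NoncrossingGraph

/-! ### Noncrossing graphs on intervals of ℕ -/

/-- The noncrossing condition for a graph on `ℕ`. -/
def IsNC (G : SimpleGraph ℕ) : Prop :=
  ∀ a b c d : ℕ, a < b → b < c → c < d → G.Adj a c → ¬ G.Adj b d

/-- All edges of `G` have both endpoints in `[a, b]`. -/
def SupportedOn (G : SimpleGraph ℕ) (a b : ℕ) : Prop :=
  ∀ u v, G.Adj u v → a ≤ u ∧ u ≤ b

/-- Every union of connected components of `G` that meets `[a, b]` contains `[a, b]`. -/
def Spans (G : SimpleGraph ℕ) (a b : ℕ) : Prop :=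
  ∀ S : Set ℕ, (∀ u v, G.Adj u v → u ∈ S → v ∈ S) →
    ∀ x y, a ≤ x → x ≤ b → a ≤ y → y ≤ b → x ∈ S → y ∈ S

/-- Connected noncrossing graphs on the interval `[a, b]`. -/
def Conn (a b : ℕ) : Set (SimpleGraph ℕ) :=
  {G | SupportedOn G a b ∧ IsNC G ∧ Spans G a b}

/-- Connected noncrossing graphs on the interval `[a, b]` that contain the edge `ab`. -/
def ConnEdge (a b : ℕ) : Set (SimpleGraph ℕ) :=
  {G | G ∈ Conn a b ∧ G.Adj a b}

/-- The edges of `G` within `[a, b]`. -/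
def restr (G : SimpleGraph ℕ) (a b : ℕ) : SimpleGraph ℕ where
  Adj u v := G.Adj u v ∧ (a ≤ u ∧ u ≤ b) ∧ a ≤ v ∧ v ≤ b
  symm := ⟨fun _ _ h => ⟨h.1.symm, h.2.2, h.2.1⟩⟩
  loopless := ⟨fun _ h => h.1.ne rfl⟩

theorem restr_adj {G : SimpleGraph ℕ} {a b u v : ℕ} :
    (restr G a b).Adj u v ↔ G.Adj u v ∧ (a ≤ u ∧ u ≤ b) ∧ a ≤ v ∧ v ≤ b := Iff.rfl

theorem SupportedOn.adj {G : SimpleGraph ℕ} {a b u v : ℕ} (h : SupportedOn G a b)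
    (huv : G.Adj u v) : (a ≤ u ∧ u ≤ b) ∧ a ≤ v ∧ v ≤ b :=
  ⟨h u v huv, h v u huv.symm⟩

theorem restr_supportedOn (G : SimpleGraph ℕ) (a b : ℕ) : SupportedOn (restr G a b) a b :=
  fun _ _ h => h.2.1

theorem IsNC.mono {G H : SimpleGraph ℕ} (h : IsNC G) (hle : ∀ u v, H.Adj u v → G.Adj u v) :
    IsNC H :=
  fun a b c d h1 h2 h3 h4 h5 => h a b c d h1 h2 h3 (hle _ _ h4) (hle _ _ h5)

theorem IsNC.restr {G : SimpleGraph ℕ} (h : IsNC G) (a b : ℕ) :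
    IsNC (restr G a b) := h.mono fun _ _ h => h.1

/-- Spanning can be tested on sets containing one fixed point. -/
theorem spans_of_base {G : SimpleGraph ℕ} {a b p : ℕ}
    (h : ∀ S : Set ℕ, (∀ u v, G.Adj u v → u ∈ S → v ∈ S) → p ∈ S →
      ∀ y, a ≤ y → y ≤ b → y ∈ S) : Spans G a b := by
  intro S hS x y hax hxb hay hyb hx
  by_cases hpS : p ∈ S
  · exact h S hS hpS y hay hyb
  -- Adjacency is symmetric, so the complement of a closed set is closed.
  · exact absurd hx (h Sᶜ (fun u v huv hu hv => hu (hS v u huv.symm hv)) hpS x hax hxb)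

theorem restr_sup_left {G H : SimpleGraph ℕ} {a k l b : ℕ} (hG : SupportedOn G a k)
    (hH : SupportedOn H l b) (hkl : k ≤ l) : restr (G ⊔ H) a k = G := by
  ext u v
  rw [restr_adj, SimpleGraph.sup_adj]
  constructor
  · rintro ⟨h | h, h2⟩
    · exact h
    · have := hH.adj h
      exact absurd (show u = v by omega) h.ne
  · intro h
    exact ⟨Or.inl h, hG.adj h⟩

theorem restr_sup_right {G H : SimpleGraph ℕ} {a k l b : ℕ} (hG : SupportedOn G a k)
    (hH : SupportedOn H l b) (hkl : k ≤ l) : restr (G ⊔ H) l b = H := by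
  ext u v
  rw [restr_adj, SimpleGraph.sup_adj]
  constructor
  · rintro ⟨h | h, h2⟩
    · have := hG.adj h
      exact absurd (show u = v by omega) h.ne
    · exact h
  · intro h
    exact ⟨Or.inr h, hH.adj h⟩

theorem SupportedOn.sup {G H : SimpleGraph ℕ} {a k l b : ℕ} (hG : SupportedOn G a k)
    (hH : SupportedOn H l b) (hal : a ≤ l) (hkb : k ≤ b) : SupportedOn (G ⊔ H) a b := by
  rintro u v (h | h)
  · have := hG.adj h; omega
  · have := hH.adj h; omega

theorem IsNC.sup {G H : SimpleGraph ℕ} {a k l b : ℕ} (hG : SupportedOn G a k)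
    (hH : SupportedOn H l b) (hkl : k ≤ l) (nG : IsNC G) (nH : IsNC H) : IsNC (G ⊔ H) := by
  rintro p q r s h1 h2 h3 (h4 | h4) (h5 | h5)
  · exact nG p q r s h1 h2 h3 h4 h5
  · have := hG.adj h4; have := hH.adj h5; omega
  · have := hH.adj h4; have := hG.adj h5; omega
  · exact nH p q r s h1 h2 h3 h4 h5

/-- Finiteness is needed for `Nat.card` to be additive and multiplicative in the counts below. -/
instance finite_conn (a b : ℕ) : Finite (Conn a b) := by
  refine Finite.of_injective
    (fun G : Conn a b => {p : Set.Icc a b × Set.Icc a b | G.1.Adj p.1 p.2}) ?_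
  rintro ⟨G, hG⟩ ⟨H, hH⟩ h
  have key : ∀ u v : Set.Icc a b, G.Adj u v ↔ H.Adj u v := fun u v =>
    Set.ext_iff.1 h (u, v)
  refine Subtype.ext (SimpleGraph.ext (funext₂ fun u v => propext ⟨fun e => ?_, fun e => ?_⟩))
  · have := hG.1.adj e
    exact (key ⟨u, this.1⟩ ⟨v, this.2⟩).1 e
  · have := hH.1.adj e
    exact (key ⟨u, this.1⟩ ⟨v, this.2⟩).2 e

instance finite_connEdge (a b : ℕ) : Finite (ConnEdge a b) :=
  Finite.of_injective (fun G : ConnEdge a b => (⟨G.1, G.2.1⟩ : Conn a b))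
    fun _ _ h => Subtype.ext (Subtype.mk.inj h)

/-! ### Transfer between `Fin (m + 1)` and intervals -/

/-- The order embedding of `Fin (m + 1)` onto `[a, a + m]`. -/
def shift (a m : ℕ) : Fin (m + 1) ↪ ℕ :=
  ⟨fun i => a + i, fun _ _ h => Fin.ext (Nat.add_left_cancel h)⟩

theorem shift_apply (a m : ℕ) (i : Fin (m + 1)) : shift a m i = a + i := rfl

theorem exists_shift {a m x : ℕ} (h : a ≤ x ∧ x ≤ a + m) : ∃ i, shift a m i = x :=
  ⟨⟨x - a, by omega⟩, by simp only [shift_apply]; omega⟩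

theorem map_shift_mem_conn {a m : ℕ} {G : SimpleGraph (Fin (m + 1))} :
    G.map (shift a m) ∈ Conn a (a + m) ↔ G.Connected ∧ G.IsNoncrossing := by
  have hadj : ∀ i j, (G.map (shift a m)).Adj (shift a m i) (shift a m j) ↔ G.Adj i j :=
    fun i j => SimpleGraph.map_adj_apply
  have hsupp : SupportedOn (G.map (shift a m)) a (a + m) := by
    rintro u v h
    obtain ⟨i, j, -, rfl, rfl⟩ := (SimpleGraph.map_adj _ _ _ _).1 h
    simp only [shift_apply]; omega
  have hnc : IsNC (G.map (shift a m)) ↔ G.IsNoncrossing := by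
    constructor
    · rintro h p q r s h1 h2 h3 ⟨h4, h5⟩
      rw [← hadj] at h4 h5
      refine h _ _ _ _ ?_ ?_ ?_ h4 h5 <;> simp only [shift_apply] <;> omega
    · intro h p q r s h1 h2 h3 h4 h5
      obtain ⟨i, k, e, rfl, rfl⟩ := (SimpleGraph.map_adj _ _ _ _).1 h4
      obtain ⟨j, l, e', rfl, rfl⟩ := (SimpleGraph.map_adj _ _ _ _).1 h5
      simp only [shift_apply] at h1 h2 h3
      exact h i j k l (by omega) (by omega) (by omega) ⟨e, e'⟩
  have hconn : Spans (G.map (shift a m)) a (a + m) ↔ G.Connected := by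
    constructor
    · intro h
      have : G.Preconnected := by
        intro i j
        have := h {x | ∃ k, shift a m k = x ∧ G.Reachable i k} ?_ (shift a m i) (shift a m j)
          (by simp [shift_apply]) (by simp only [shift_apply]; omega)
          (by simp [shift_apply]) (by simp only [shift_apply]; omega) ⟨i, rfl, .refl i⟩
        · obtain ⟨k, hk, hr⟩ := this
          rwa [(shift a m).injective hk] at hr
        · rintro u v huv ⟨k, rfl, hk⟩
          obtain ⟨i', j', e, h1, rfl⟩ := (SimpleGraph.map_adj _ _ _ _).1 huv
          rw [(shift a m).injective h1] at e
          exact ⟨j', rfl, hk.trans e.reachable⟩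
      exact ⟨this⟩
    · intro h S hS x y hax hxb hay hyb hx
      obtain ⟨i, rfl⟩ := exists_shift ⟨hax, hxb⟩
      obtain ⟨j, rfl⟩ := exists_shift ⟨hay, hyb⟩
      obtain ⟨w⟩ := h.preconnected i j
      induction w with
      | nil => exact hx
      | @cons u v w e p ih =>
        refine ih ?_ ?_ (hS _ _ ((hadj _ _).2 e) hx) hay hyb <;> simp only [shift_apply] <;> omega
  constructor
  · exact fun h => ⟨hconn.1 h.2.2, hnc.1 h.2.1⟩
  · exact fun h => ⟨hsupp, hnc.2 h.2, hconn.2 h.1⟩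

theorem map_comap_shift {a m : ℕ} {G : SimpleGraph ℕ} (h : SupportedOn G a (a + m)) :
    (G.comap (shift a m)).map (shift a m) = G := by
  ext u v
  rw [SimpleGraph.map_adj]
  constructor
  · rintro ⟨i, j, e, rfl, rfl⟩
    exact e
  · intro e
    obtain ⟨i, rfl⟩ := exists_shift (h.adj e).1
    obtain ⟨j, rfl⟩ := exists_shift (h.adj e).2
    exact ⟨i, j, e, rfl, rfl⟩

/-- The count is independent of the left endpoint, so pieces starting at `k + 1` are counted by the
same sequence. -/
theorem card_conn (a m : ℕ) :
    Nat.card (Conn a (a + m)) = numConnectedNoncrossing (m + 1) := by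
  symm
  refine Nat.card_eq_of_bijective
    (fun G : {G : SimpleGraph (Fin (m + 1)) // G.Connected ∧ G.IsNoncrossing} =>
      (⟨G.1.map (shift a m), map_shift_mem_conn.2 G.2⟩ : Conn a (a + m))) ⟨?_, ?_⟩
  · intro G H h
    exact Subtype.ext (SimpleGraph.map_injective _ (congrArg Subtype.val h))
  · rintro ⟨G, hG⟩
    have e := map_comap_shift hG.1
    exact ⟨⟨G.comap (shift a m), map_shift_mem_conn.1 (by rwa [e])⟩, Subtype.ext e⟩

/-! ### Splitting at the largest neighbour of 0 -/

theorem sup_mem_conn {G H : SimpleGraph ℕ} {k b : ℕ} (hkb : k ≤ b) (hG : G ∈ ConnEdge 0 k)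
    (hH : H ∈ Conn k b) : G ⊔ H ∈ Conn 0 b := by
  refine ⟨hG.1.1.sup hH.1 (Nat.zero_le _) hkb, IsNC.sup hG.1.1 hH.1 le_rfl hG.1.2.1 hH.2.1,
    spans_of_base (p := k) fun S hS hk y _ hyb => ?_⟩
  rcases le_total y k with h | h
  · exact hG.1.2.2 S (fun u v e => hS u v (Or.inl e)) k y (Nat.zero_le _) le_rfl
      (Nat.zero_le _) h hk
  · exact hH.2.2 S (fun u v e => hS u v (Or.inr e)) k y le_rfl hkb h hyb hk

theorem exists_adj_zero {G : SimpleGraph ℕ} {b : ℕ} (hb : 0 < b) (hG : G ∈ Conn 0 b) :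
    ∃ v, G.Adj 0 v := by
  by_contra! h
  have := hG.2.2 {0} (by rintro u v e rfl; exact absurd e (h v)) 0 b le_rfl (Nat.zero_le _)
    (Nat.zero_le _) le_rfl rfl
  exact hb.ne' this

theorem exists_max_adj_zero {G : SimpleGraph ℕ} {b : ℕ} (hb : 0 < b) (hG : G ∈ Conn 0 b) :
    ∃ k, G.Adj 0 k ∧ ∀ v, G.Adj 0 v → v ≤ k := by
  have hbdd : BddAbove {v | G.Adj 0 v} := ⟨b, fun v hv => (hG.1.adj hv).2.2⟩
  exact ⟨sSup {v | G.Adj 0 v}, Nat.sSup_mem (exists_adj_zero hb hG) hbdd,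
    fun v hv => le_csSup hbdd hv⟩

/-- An edge jumping strictly over `k` would cross the chord from 0 to `k` or, if it starts at 0,
contradict maximality. Hence `k` is a cut point. -/
theorem eq_of_adj_of_lt {G : SimpleGraph ℕ} {k b : ℕ} (hG : G ∈ Conn 0 b) (hk : G.Adj 0 k)
    (hmax : ∀ v, G.Adj 0 v → v ≤ k) {u v : ℕ} (e : G.Adj u v) (hu : u ≤ k) (hv : k < v) :
    u = k := by
  by_contra hne
  rcases Nat.eq_zero_or_pos u with rfl | hpos
  · exact absurd (hmax v e) (by omega)
  · exact hG.2.1 0 u k v hpos (by omega) hv hk e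

theorem restr_left_mem {G : SimpleGraph ℕ} {k b : ℕ} (hG : G ∈ Conn 0 b) (hk : G.Adj 0 k)
    (hmax : ∀ v, G.Adj 0 v → v ≤ k) :
    restr G 0 k ∈ ConnEdge 0 k := by
  have hkb := (hG.1.adj hk).2.2
  have hadj : (restr G 0 k).Adj 0 k := ⟨hk, by omega, by omega⟩
  refine ⟨⟨restr_supportedOn _ _ _, hG.2.1.restr _ _, spans_of_base (p := k) ?_⟩, hadj⟩
  intro S hS hkS y _ hyk
  -- Adding everything beyond `k` makes `S` closed in `G`, since edges back into `[0, k]` land on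
  -- `k`, which is in `S`.
  have := hG.2.2 {x | x ∈ S ∨ k < x} ?_ k y (by omega) (by omega) (by omega) (by omega) (Or.inl hkS)
  · exact this.resolve_right (by omega)
  · intro u v e hu
    by_cases hv : k < v
    · exact Or.inr hv
    by_cases huk : k < u
    · exact Or.inl (by rwa [eq_of_adj_of_lt hG hk hmax e.symm (by omega) huk])
    · exact Or.inl (hS u v ⟨e, by omega, by omega⟩ (hu.resolve_right huk))

theorem restr_right_mem {G : SimpleGraph ℕ} {k b : ℕ} (hG : G ∈ Conn 0 b) (hk : G.Adj 0 k)
    (hmax : ∀ v, G.Adj 0 v → v ≤ k) :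
    restr G k b ∈ Conn k b := by
  have hkb := (hG.1.adj hk).2.2
  refine ⟨restr_supportedOn _ _ _, hG.2.1.restr _ _, spans_of_base (p := k) ?_⟩
  intro S hS hkS y hky hyb
  have := hG.2.2 {x | x ∈ S ∨ x < k} ?_ k y (by omega) (by omega) (by omega) (by omega) (Or.inl hkS)
  · exact this.resolve_right (by omega)
  · intro u v e hu
    have := hG.1.adj e
    by_cases hv : v < k
    · exact Or.inr hv
    by_cases huk : u < k
    · rcases (show v = k ∨ k < v by omega) with rfl | hv
      · exact Or.inl hkS
      · exact absurd (eq_of_adj_of_lt hG hk hmax e huk.le hv) huk.ne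
    · exact Or.inl (hS u v ⟨e, by omega, by omega⟩ (hu.resolve_right huk))

theorem restr_sup_restr {G : SimpleGraph ℕ} {k b : ℕ} (hG : G ∈ Conn 0 b) (hk : G.Adj 0 k)
    (hmax : ∀ v, G.Adj 0 v → v ≤ k) :
    restr G 0 k ⊔ restr G k b = G := by
  ext u v
  rw [SimpleGraph.sup_adj, restr_adj, restr_adj]
  refine ⟨fun h => h.elim And.left And.left, fun e => ?_⟩
  have := hG.1.adj e
  have h1 := eq_of_adj_of_lt hG hk hmax e
  have h2 := eq_of_adj_of_lt hG hk hmax e.symm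
  have : (u ≤ k ∧ v ≤ k) ∨ (k ≤ u ∧ k ≤ v) := by omega
  rcases this with h | h
  · exact Or.inl ⟨e, by omega, by omega⟩
  · exact Or.inr ⟨e, by omega, by omega⟩

theorem le_of_sup_adj_zero {G H : SimpleGraph ℕ} {k b v : ℕ} (hk : 0 < k) (hG : G ∈ ConnEdge 0 k)
    (hH : H ∈ Conn k b) (h : (G ⊔ H).Adj 0 v) : v ≤ k := by
  rcases h with h | h
  · exact (hG.1.1.adj h).2.2
  · have := (hH.1.adj h); omega

/-- Splitting a connected noncrossing graph at the largest neighbour of its first vertex. -/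
theorem card_conn_eq_sum_connEdge (m : ℕ) :
    Nat.card (Conn 0 (m + 1)) =
      ∑ k : Fin (m + 1), Nat.card (ConnEdge 0 (k + 1)) * Nat.card (Conn (k + 1) (m + 1)) := by
  simp_rw [← Nat.card_prod]
  rw [← Nat.card_sigma]
  symm
  refine Nat.card_eq_of_bijective
    (fun p : Σ k : Fin (m + 1), ConnEdge 0 (k + 1) × Conn (k + 1) (m + 1) =>
      (⟨p.2.1.1 ⊔ p.2.2.1, sup_mem_conn (by omega) p.2.1.2 p.2.2.2⟩ : Conn 0 (m + 1))) ⟨?_, ?_⟩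
  · rintro ⟨k, ⟨G, hG⟩, ⟨H, hH⟩⟩ ⟨k', ⟨G', hG'⟩, ⟨H', hH'⟩⟩ h
    replace h : G ⊔ H = G' ⊔ H' := Subtype.mk.inj h
    have h1 := le_of_sup_adj_zero (Nat.succ_pos _) hG hH (by rw [h]; exact Or.inl hG'.2)
    have h2 := le_of_sup_adj_zero (Nat.succ_pos _) hG' hH' (by rw [← h]; exact Or.inl hG.2)
    obtain rfl : k = k' := by omega
    have e1 : G = G' := by
      rw [← restr_sup_left hG.1.1 hH.1 le_rfl, h, restr_sup_left hG'.1.1 hH'.1 le_rfl]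
    have e2 : H = H' := by
      rw [← restr_sup_right hG.1.1 hH.1 le_rfl, h, restr_sup_right hG'.1.1 hH'.1 le_rfl]
    subst e1 e2
    rfl
  · rintro ⟨G, hG⟩
    obtain ⟨k, hk, hmax⟩ := exists_max_adj_zero (Nat.succ_pos m) hG
    have hkb := (hG.1.adj hk).2.2
    obtain ⟨j, rfl⟩ : ∃ j, k = j + 1 := ⟨k - 1, by have := hk.ne; omega⟩
    exact ⟨⟨⟨j, by omega⟩, ⟨_, restr_left_mem hG hk hmax⟩, ⟨_, restr_right_mem hG hk hmax⟩⟩,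
      Subtype.ext (restr_sup_restr hG hk hmax)⟩

/-! ### Deleting the edge from 0 to b -/

/-- `G` without the edge `ab`. -/
def del (G : SimpleGraph ℕ) (a b : ℕ) : SimpleGraph ℕ where
  Adj u v := G.Adj u v ∧ ¬ (u = a ∧ v = b) ∧ ¬ (u = b ∧ v = a)
  symm := ⟨fun _ _ h => ⟨h.1.symm, by tauto, by tauto⟩⟩
  loopless := ⟨fun _ h => h.1.ne rfl⟩

theorem del_adj {G : SimpleGraph ℕ} {a b u v : ℕ} :
    (del G a b).Adj u v ↔ G.Adj u v ∧ ¬ (u = a ∧ v = b) ∧ ¬ (u = b ∧ v = a) := Iff.rfl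

theorem del_sup_edge {G : SimpleGraph ℕ} {a b : ℕ} (h : G.Adj a b) :
    del G a b ⊔ SimpleGraph.edge a b = G := by
  ext u v
  rw [SimpleGraph.sup_adj, del_adj, SimpleGraph.edge_adj]
  constructor
  · rintro (h' | ⟨⟨rfl, rfl⟩ | ⟨rfl, rfl⟩, -⟩)
    exacts [h'.1, h, h.symm]
  · intro e
    have := e.ne
    tauto

theorem sup_edge_del {G : SimpleGraph ℕ} {a b : ℕ} (h : ¬ G.Adj a b) :
    del (G ⊔ SimpleGraph.edge a b) a b = G := by
  ext u v
  rw [del_adj, SimpleGraph.sup_adj, SimpleGraph.edge_adj]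
  constructor
  · tauto
  · intro e
    refine ⟨Or.inl e, ?_, ?_⟩
    · rintro ⟨rfl, rfl⟩; exact h e
    · rintro ⟨rfl, rfl⟩; exact h e.symm

theorem IsNC.sup_edge {G : SimpleGraph ℕ} {b : ℕ} (hs : SupportedOn G 0 b) (h : IsNC G) :
    IsNC (G ⊔ SimpleGraph.edge 0 b) := by
  intro p q r s h1 h2 h3 h4 h5
  rw [SimpleGraph.sup_adj, SimpleGraph.edge_adj] at h4 h5
  rcases h4 with h4 | h4 <;> rcases h5 with h5 | h5
  · exact h p q r s h1 h2 h3 h4 h5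
  · omega
  · have := hs.adj h5; omega
  · omega

theorem SupportedOn.sup_edge {G : SimpleGraph ℕ} {b : ℕ} (hs : SupportedOn G 0 b) :
    SupportedOn (G ⊔ SimpleGraph.edge 0 b) 0 b := by
  intro u v h
  rw [SimpleGraph.sup_adj, SimpleGraph.edge_adj] at h
  rcases h with h | h
  · exact hs u v h
  · omega

theorem sup_edge_mem_of_conn {G : SimpleGraph ℕ} {b : ℕ} (hb : 0 < b) (hG : G ∈ Conn 0 b) :
    G ⊔ SimpleGraph.edge 0 b ∈ ConnEdge 0 b :=
  ⟨⟨hG.1.sup_edge, hG.2.1.sup_edge hG.1, fun S hS => hG.2.2 S fun u v e => hS u v (Or.inl e)⟩,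
    Or.inr ((SimpleGraph.edge_adj ..).2 ⟨Or.inl ⟨rfl, rfl⟩, hb.ne⟩)⟩

theorem sup_sup_edge_mem {G H : SimpleGraph ℕ} {k b : ℕ} (hkb : k < b) (hG : G ∈ Conn 0 k)
    (hH : H ∈ Conn (k + 1) b) : G ⊔ H ⊔ SimpleGraph.edge 0 b ∈ ConnEdge 0 b := by
  have hs : SupportedOn (G ⊔ H) 0 b := hG.1.sup hH.1 (Nat.zero_le _) hkb.le
  have he : (G ⊔ H ⊔ SimpleGraph.edge 0 b).Adj 0 b :=
    Or.inr ((SimpleGraph.edge_adj ..).2 ⟨Or.inl ⟨rfl, rfl⟩, by omega⟩)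
  refine ⟨⟨hs.sup_edge, (IsNC.sup hG.1 hH.1 (Nat.le_succ k) hG.2.1 hH.2.1).sup_edge hs,
    spans_of_base (p := 0) fun S hS h0 y _ hyb => ?_⟩, he⟩
  rcases le_or_gt y k with h | h
  · exact hG.2.2 S (fun u v e => hS u v (Or.inl (Or.inl e))) 0 y le_rfl (Nat.zero_le _)
      (Nat.zero_le _) h h0
  · exact hH.2.2 S (fun u v e => hS u v (Or.inl (Or.inr e))) b y hkb le_rfl h hyb (hS _ _ he h0)

theorem sup_closed_Iic {G H : SimpleGraph ℕ} {k b u v : ℕ} (hG : SupportedOn G 0 k)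
    (hH : SupportedOn H (k + 1) b) (e : (G ⊔ H).Adj u v) (hu : u ≤ k) : v ≤ k := by
  rcases e with e | e
  · exact (hG.adj e).2.2
  · have := hH.adj e; omega

theorem sup_not_mem_conn {G H : SimpleGraph ℕ} {k b : ℕ} (hkb : k < b) (hG : SupportedOn G 0 k)
    (hH : SupportedOn H (k + 1) b) : G ⊔ H ∉ Conn 0 b := fun h =>
  absurd (h.2.2 {x | x ≤ k} (fun _ _ e hu => sup_closed_Iic hG hH e hu) 0 b le_rfl
    (Nat.zero_le _) (Nat.zero_le _) le_rfl (Nat.zero_le k)) (by simpa using hkb)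

theorem sup_not_adj {G H : SimpleGraph ℕ} {k b : ℕ} (hkb : k < b) (hG : SupportedOn G 0 k)
    (hH : SupportedOn H (k + 1) b) : ¬ (G ⊔ H).Adj 0 b := fun h =>
  absurd (sup_closed_Iic hG hH h (Nat.zero_le k)) (by omega)

/-- The initial segment up to `k` is closed under the edges of `G'`, which connects all of `[0,
k']`. Used in both directions, this makes the cut position unique. -/
theorem le_of_sup_eq_sup {G H G' H' : SimpleGraph ℕ} {k k' b : ℕ}
    (hG : SupportedOn G 0 k) (hH : SupportedOn H (k + 1) b) (hG' : G' ∈ Conn 0 k')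
    (h : G ⊔ H = G' ⊔ H') : k' ≤ k :=
  hG'.2.2 {x | x ≤ k} (fun _ _ e hu => sup_closed_Iic hG hH (h ▸ Or.inl e) hu) 0 k' le_rfl
    (Nat.zero_le _) (Nat.zero_le _) le_rfl (Nat.zero_le k)

/-- If deleting the edge `0b` disconnects a connected noncrossing graph, the two components are
intervals. -/
theorem exists_split_of_del_not_mem {G : SimpleGraph ℕ} {b : ℕ} (hG : G ∈ ConnEdge 0 b)
    (hd : del G 0 b ∉ Conn 0 b) : ∃ k < b, restr (del G 0 b) 0 k ∈ Conn 0 k ∧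
      restr (del G 0 b) (k + 1) b ∈ Conn (k + 1) b ∧
      restr (del G 0 b) 0 k ⊔ restr (del G 0 b) (k + 1) b = del G 0 b := by
  obtain ⟨⟨hs, hnc, hsp⟩, hadj⟩ := hG
  set D := del G 0 b
  have hDG : ∀ u v, D.Adj u v → G.Adj u v := fun u v e => e.1
  have hDs : SupportedOn D 0 b := fun u v e => hs u v e.1
  have hDnc : IsNC D := hnc.mono hDG
  have hclosed : ∀ S : Set ℕ, (∀ u v, D.Adj u v → u ∈ S → v ∈ S) → 0 ∈ S → b ∈ S →
      ∀ y ≤ b, y ∈ S := by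
    intro S hS h0 hb y hy
    refine hsp S (fun u v e hu => ?_) 0 y le_rfl (Nat.zero_le _) (Nat.zero_le _) hy h0
    by_cases h1 : u = 0 ∧ v = b
    · rwa [h1.2]
    by_cases h2 : u = b ∧ v = 0
    · rwa [h2.2]
    exact hS u v ⟨e, h1, h2⟩ hu
  -- The component of 0 after deletion. It misses `b`, and every other vertex of `[0, b]` lies in
  -- the component of `b`.
  let T : Set ℕ := {x | D.Reachable 0 x}
  have hTc : ∀ u v, D.Adj u v → u ∈ T → v ∈ T := fun u v e hu => hu.trans e.reachable
  have hTmin : ∀ S : Set ℕ, (∀ u v, D.Adj u v → u ∈ S → v ∈ S) → 0 ∈ S → T ⊆ S := by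
    rintro S hS h0 x ⟨w⟩
    generalize 0 = z at w h0
    induction w with
    | nil => exact h0
    | cons e _ ih => exact ih (hS _ _ e h0)
  have h0T : 0 ∈ T := .refl 0
  have hbT : b ∉ T := fun hbT => hd ⟨hDs, hDnc, spans_of_base (p := 0) fun S hS h0 y _ hy =>
    hclosed S hS h0 (hTmin S hS h0 hbT) y hy⟩
  have hTmin' : ∀ S : Set ℕ, (∀ u v, D.Adj u v → u ∈ S → v ∈ S) → b ∈ S →
      ∀ y ≤ b, y ∉ T → y ∈ S := by
    intro S hS hb y hy hyT
    refine (hclosed (S ∪ T) ?_ (Or.inr h0T) (Or.inl hb) y hy).resolve_right hyT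
    rintro u v e (hu | hu)
    exacts [Or.inl (hS u v e hu), Or.inr (hTc u v e hu)]
  classical
  have hex : ∃ x, x ∉ T := ⟨b, hbT⟩
  obtain ⟨k, hk⟩ : ∃ k, Nat.find hex = k + 1 :=
    Nat.exists_eq_succ_of_ne_zero fun h => absurd h0T (h ▸ Nat.find_spec hex)
  have hkT : k + 1 ∉ T := hk ▸ Nat.find_spec hex
  have hlt : ∀ x ≤ k, x ∈ T := fun x hx => not_not.1 (Nat.find_min hex (by omega))
  have hkb : k + 1 ≤ b := hk ▸ Nat.find_min' hex hbT
  -- Here `k + 1` is the least vertex outside `T`. An edge `uv` leaving `[0, k]` would lie in `T`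
  -- and enclose `k + 1`, separating it from `b`.
  have hcut : ∀ u v, D.Adj u v → u ≤ k → v ≤ k := by
    intro u v e hu
    by_contra hv
    have hvT : v ∈ T := hTc u v e (hlt u hu)
    have hv1 : v ≠ k + 1 := fun h => hkT (h ▸ hvT)
    have hvb : v ≠ b := fun h => hbT (h ▸ hvT)
    have := hDs.adj e
    -- The vertices outside both `T` and `[u, v]` form a closed set, because an edge leaving it
    -- would cross `uv`. It contains `b` but not `k + 1`.
    refine absurd (hTmin' {x | x ∉ T ∧ (x < u ∨ v < x)} ?_ ⟨hbT, Or.inr (by omega)⟩ (k + 1) hkb hkT)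
      (by rintro ⟨-, h⟩; omega)
    rintro x y exy ⟨hxT, hx⟩
    have hyT : y ∉ T := fun h => hxT (hTc y x exy.symm h)
    refine ⟨hyT, ?_⟩
    by_contra hy
    have hyu : y ≠ u := fun h => hyT (h ▸ hlt u hu)
    have hyv : y ≠ v := fun h => hyT (h ▸ hvT)
    rcases hx with hx | hx
    · exact hDnc x u y v hx (by omega) (by omega) exy e
    · exact hDnc u y v x (by omega) (by omega) hx e exy.symm
  have hTk : ∀ x ∈ T, x ≤ k := fun x hx =>
    hTmin {x | x ≤ k} (fun u v e hu => hcut u v e hu) (Nat.zero_le k) hx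
  refine ⟨k, hkb, ⟨restr_supportedOn _ _ _, hDnc.restr _ _, spans_of_base (p := 0) ?_⟩,
    ⟨restr_supportedOn _ _ _, hDnc.restr _ _, spans_of_base (p := b) ?_⟩, ?_⟩
  · intro S hS h0 y _ hy
    refine (hTmin {x | x ∈ S ∧ x ≤ k} ?_ ⟨h0, Nat.zero_le _⟩ (hlt y hy)).1
    rintro u v e ⟨hu, huk⟩
    have := hcut u v e huk
    exact ⟨hS u v ⟨e, by omega, by omega⟩ hu, this⟩
  · intro S hS hb y hky hy
    refine (hTmin' {x | x ∈ S ∧ k < x} ?_ ⟨hb, hkb⟩ y hy fun h => ?_).1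
    · rintro u v e ⟨hu, huk⟩
      have h1 := hcut v u e.symm
      have := hDs.adj e
      exact ⟨hS u v ⟨e, by omega, by omega⟩ hu, show k < v by omega⟩
    · exact absurd (hTk y h) (by omega)
  · ext u v
    rw [SimpleGraph.sup_adj, restr_adj, restr_adj]
    refine ⟨fun h => h.elim And.left And.left, fun e => ?_⟩
    have := hDs.adj e
    have h1 := hcut u v e
    have h2 := hcut v u e.symm
    by_cases hu : u ≤ k
    · exact Or.inl ⟨e, by omega, by omega⟩
    · exact Or.inr ⟨e, by omega, by omega⟩

/-- Connected noncrossing graphs on `[a, b]` without the edge `ab`. -/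
def ConnNoEdge (a b : ℕ) : Set (SimpleGraph ℕ) :=
  {G | G ∈ Conn a b ∧ ¬ G.Adj a b}

instance finite_connNoEdge (a b : ℕ) : Finite (ConnNoEdge a b) :=
  Finite.of_injective (fun G : ConnNoEdge a b => (⟨G.1, G.2.1⟩ : Conn a b))
    fun _ _ h => Subtype.ext (Subtype.mk.inj h)

theorem card_connEdge_add_card_connNoEdge (a b : ℕ) :
    Nat.card (ConnEdge a b) + Nat.card (ConnNoEdge a b) = Nat.card (Conn a b) := by
  rw [← Nat.card_sum]
  refine Nat.card_eq_of_bijective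
    (Sum.elim (fun G : ConnEdge a b => (⟨G.1, G.2.1⟩ : Conn a b))
      fun G : ConnNoEdge a b => (⟨G.1, G.2.1⟩ : Conn a b)) ⟨?_, ?_⟩
  · rintro (⟨G, hG⟩ | ⟨G, hG⟩) (⟨H, hH⟩ | ⟨H, hH⟩) h <;>
      obtain rfl : G = H := Subtype.mk.inj h
    exacts [rfl, absurd hG.2 hH.2, absurd hH.2 hG.2, rfl]
  · rintro ⟨G, hG⟩
    by_cases h : G.Adj a b
    exacts [⟨.inl ⟨G, hG, h⟩, rfl⟩, ⟨.inr ⟨G, hG, h⟩, rfl⟩]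

/-- Deleting the edge `0b` leaves a connected graph or two connected graphs on intervals. -/
theorem card_connEdge_eq (m : ℕ) :
    Nat.card (ConnEdge 0 (m + 1)) = Nat.card (ConnNoEdge 0 (m + 1)) +
      ∑ k : Fin (m + 1), Nat.card (Conn 0 k) * Nat.card (Conn (k + 1) (m + 1)) := by
  simp_rw [← Nat.card_prod]
  rw [← Nat.card_sigma, ← Nat.card_sum]
  symm
  refine Nat.card_eq_of_bijective
    (Sum.elim (fun G : ConnNoEdge 0 (m + 1) => (⟨_, sup_edge_mem_of_conn (Nat.succ_pos m) G.2.1⟩ :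
        ConnEdge 0 (m + 1)))
      (fun p : Σ k : Fin (m + 1), Conn 0 k × Conn (k + 1) (m + 1) =>
        (⟨_, sup_sup_edge_mem p.1.2 p.2.1.2 p.2.2.2⟩ : ConnEdge 0 (m + 1)))) ⟨?_, ?_⟩
  · have hdel : ∀ {G H : SimpleGraph ℕ}, ¬ G.Adj 0 (m + 1) → ¬ H.Adj 0 (m + 1) →
        G ⊔ SimpleGraph.edge 0 (m + 1) = H ⊔ SimpleGraph.edge 0 (m + 1) → G = H := by
      intro G H hG hH h
      rw [← sup_edge_del hG, h, sup_edge_del hH]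
    rintro (⟨G, hG⟩ | ⟨k, ⟨G, hG⟩, ⟨H, hH⟩⟩) (⟨G', hG'⟩ | ⟨k', ⟨G', hG'⟩, ⟨H', hH'⟩⟩) h
    · obtain rfl : G = G' := hdel hG.2 hG'.2 (Subtype.mk.inj h)
      rfl
    · obtain rfl : G = G' ⊔ H' := hdel hG.2 (sup_not_adj k'.2 hG'.1 hH'.1) (Subtype.mk.inj h)
      exact absurd hG.1 (sup_not_mem_conn k'.2 hG'.1 hH'.1)
    · obtain rfl : G ⊔ H = G' := hdel (sup_not_adj k.2 hG.1 hH.1) hG'.2 (Subtype.mk.inj h)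
      exact absurd hG'.1 (sup_not_mem_conn k.2 hG.1 hH.1)
    · replace h : G ⊔ H = G' ⊔ H' := hdel (sup_not_adj k.2 hG.1 hH.1) (sup_not_adj k'.2 hG'.1 hH'.1)
        (Subtype.mk.inj h)
      have h1 := le_of_sup_eq_sup hG.1 hH.1 hG' h
      have h2 := le_of_sup_eq_sup hG'.1 hH'.1 hG h.symm
      obtain rfl : k = k' := by omega
      have hk := Nat.le_succ (k : ℕ)
      have e1 : G = G' := by
        rw [← restr_sup_left hG.1 hH.1 hk, h, restr_sup_left hG'.1 hH'.1 hk]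
      have e2 : H = H' := by
        rw [← restr_sup_right hG.1 hH.1 hk, h, restr_sup_right hG'.1 hH'.1 hk]
      subst e1 e2
      rfl
  · rintro ⟨G, hG⟩
    by_cases hd : del G 0 (m + 1) ∈ Conn 0 (m + 1)
    · exact ⟨.inl ⟨_, hd, fun h => h.2.1 ⟨rfl, rfl⟩⟩, Subtype.ext (del_sup_edge hG.2)⟩
    · obtain ⟨k, hk, h1, h2, h3⟩ := exists_split_of_del_not_mem hG hd
      refine ⟨.inr ⟨⟨k, hk⟩, ⟨_, h1⟩, ⟨_, h2⟩⟩, Subtype.ext ?_⟩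
      exact (congrArg (· ⊔ SimpleGraph.edge 0 (m + 1)) h3).trans (del_sup_edge hG.2)

/-! ### Recurrences and generating functions -/

theorem numConnectedNoncrossing_one : numConnectedNoncrossing 1 = 1 := by
  rw [← card_conn 0 0]
  have : Subsingleton (Conn 0 (0 + 0)) := by
    refine ⟨fun ⟨G, hG⟩ ⟨H, hH⟩ => Subtype.ext (SimpleGraph.ext (funext₂ fun u v => propext ?_))⟩
    constructor <;> intro e
    · have := hG.1.adj e; exact absurd (show u = v by omega) e.ne
    · have := hH.1.adj e; exact absurd (show u = v by omega) e.ne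
  have : Nonempty (Conn 0 (0 + 0)) := ⟨⟨⊥, fun u v e => e.elim, fun _ _ _ _ _ _ _ e => e.elim,
    fun S _ x y _ hx _ hy h => by rwa [show y = x by omega]⟩⟩
  exact Nat.card_unique

theorem numConnectedNoncrossing_eq_sum_edge (m : ℕ) :
    numConnectedNoncrossing (m + 2) = ∑ k ∈ Finset.range (m + 1),
      Nat.card (ConnEdge 0 (k + 1)) * numConnectedNoncrossing (m - k + 1) := by
  rw [← card_conn 0 (m + 1), Nat.zero_add, card_conn_eq_sum_connEdge,
    ← Fin.sum_univ_eq_sum_range (fun k => Nat.card (ConnEdge 0 (k + 1)) *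
      numConnectedNoncrossing (m - k + 1))]
  refine Finset.sum_congr rfl fun k _ => ?_
  rw [← card_conn (k + 1) (m - k), show (k : ℕ) + 1 + (m - k) = m + 1 by omega]

/-- The graphs without the outer edge occur in two relations, `card_connEdge_eq` and
`card_connEdge_add_card_connNoEdge`; eliminating them produces the factor 2. -/
theorem two_mul_card_connEdge (m : ℕ) :
    2 * Nat.card (ConnEdge 0 (m + 1)) = numConnectedNoncrossing (m + 2) +
      ∑ k ∈ Finset.range (m + 1),
        numConnectedNoncrossing (k + 1) * numConnectedNoncrossing (m - k + 1) := by
  have h1 := card_connEdge_eq m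
  have h2 := card_connEdge_add_card_connNoEdge 0 (m + 1)
  have h3 := card_conn 0 (m + 1)
  rw [Nat.zero_add] at h3
  have h4 : ∑ k : Fin (m + 1), Nat.card (Conn 0 k) * Nat.card (Conn (k + 1) (m + 1)) =
      ∑ k ∈ Finset.range (m + 1),
        numConnectedNoncrossing (k + 1) * numConnectedNoncrossing (m - k + 1) := by
    rw [← Fin.sum_univ_eq_sum_range (fun k => numConnectedNoncrossing (k + 1) *
      numConnectedNoncrossing (m - k + 1))]
    refine Finset.sum_congr rfl fun k _ => ?_
    rw [← card_conn (k + 1) (m - k), show (k : ℕ) + 1 + (m - k) = m + 1 by omega,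
      ← card_conn 0 k, Nat.zero_add]
  rw [h4] at h1
  rw [show m + 1 + 1 = m + 2 from rfl] at h3
  omega

open PowerSeries

/-- The generating function of connected noncrossing graphs, by number of vertices minus one. -/
noncomputable def connGF : ℚ⟦X⟧ := mk fun m => (numConnectedNoncrossing (m + 1) : ℚ)

/-- The generating function of connected noncrossing graphs containing the edge joining the first
and the last vertex, by number of vertices minus two. -/
noncomputable def connEdgeGF : ℚ⟦X⟧ := mk fun m => (Nat.card (ConnEdge 0 (m + 1)) : ℚ)

theorem connGF_eq_one_add : connGF = 1 + X * (connEdgeGF * connGF) := by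
  ext (_ | m)
  · simp [connGF, numConnectedNoncrossing_one]
  · rw [map_add, coeff_succ_X_mul, coeff_mul, coeff_one, if_neg (Nat.succ_ne_zero m), zero_add,
      Finset.Nat.sum_antidiagonal_eq_sum_range_succ (fun i j => coeff i connEdgeGF * coeff j connGF)]
    simp only [connGF, connEdgeGF, coeff_mk]
    exact_mod_cast numConnectedNoncrossing_eq_sum_edge m

theorem two_mul_connEdgeGF : 2 * (X * connEdgeGF) = connGF - 1 + X * (connGF * connGF) := by
  rw [show (2 : ℚ⟦X⟧) = C (2 : ℚ) from (map_ofNat C 2).symm]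
  ext (_ | m)
  · simp [connGF, numConnectedNoncrossing_one]
  · rw [map_add, coeff_succ_X_mul, coeff_C_mul, coeff_succ_X_mul, coeff_mul, map_sub, coeff_one,
      if_neg (Nat.succ_ne_zero m), sub_zero,
      Finset.Nat.sum_antidiagonal_eq_sum_range_succ (fun i j => coeff i connGF * coeff j connGF)]
    simp only [connGF, connEdgeGF, coeff_mk]
    exact_mod_cast two_mul_card_connEdge m

theorem connGF_cubic : X * connGF ^ 3 + connGF ^ 2 - 3 * connGF + 2 = 0 := by
  linear_combination (-2 : ℚ⟦X⟧) * connGF_eq_one_add - connGF * two_mul_connEdgeGF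

theorem constantCoeff_connGF : constantCoeff connGF = 1 := by
  rw [← coeff_zero_eq_constantCoeff_apply]
  simp [connGF, numConnectedNoncrossing_one]

/-! ### Reduction to a trinomial equation -/

/-- The substitution that turns the cubic for the generating function into `s - s³ = 4X`. -/
noncomputable def trinomialRoot : ℚ⟦X⟧ := 2 * connGF⁻¹ - 1

theorem one_add_trinomialRoot_mul : (1 + trinomialRoot) * connGF = 2 := by
  have h : connGF * connGF⁻¹ = 1 :=
    PowerSeries.mul_inv_cancel _ (by rw [constantCoeff_connGF]; exact one_ne_zero)
  rw [trinomialRoot]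
  linear_combination 2 * h

theorem constantCoeff_trinomialRoot : constantCoeff trinomialRoot = 1 := by
  have := congrArg constantCoeff one_add_trinomialRoot_mul
  rw [map_mul, constantCoeff_connGF, map_add, map_one, map_ofNat] at this
  linarith

theorem trinomialRoot_eq : trinomialRoot - trinomialRoot ^ 3 = 4 * X := by
  have hC : connGF ^ 3 ≠ 0 := pow_ne_zero _ fun h => by
    have := constantCoeff_connGF
    rw [h, map_zero] at this
    exact zero_ne_one this
  have h := one_add_trinomialRoot_mul
  have hs : trinomialRoot * connGF = 2 - connGF := by linear_combination h
  refine mul_right_cancel₀ hC ?_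
  have e : (trinomialRoot - trinomialRoot ^ 3) * connGF ^ 3 =
      (trinomialRoot * connGF) * connGF ^ 2 - (trinomialRoot * connGF) ^ 3 := by ring
  rw [e, hs]
  linear_combination (-4 : ℚ⟦X⟧) * connGF_cubic

/-- Cancel `1 + s` from s(1 - s)(1 + s) = 4X = 2X(1 + s)C. This makes the counts linear in the
coefficients of s and s². -/
theorem trinomialRoot_sub_sq : trinomialRoot - trinomialRoot ^ 2 = 2 * (X * connGF) := by
  have h0 : (1 : ℚ⟦X⟧) + trinomialRoot ≠ 0 := fun h => by
    have := congrArg constantCoeff h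
    rw [map_add, map_one, constantCoeff_trinomialRoot, map_zero] at this
    norm_num at this
  refine mul_right_cancel₀ h0 ?_
  linear_combination trinomialRoot_eq - 2 * X * one_add_trinomialRoot_mul

/-! ### Differential equations for s and s² -/

section ODE

variable {s : ℚ⟦X⟧}

theorem derivative_trinomial (hs : s - s ^ 3 = 4 * X) : d⁄dX ℚ s * (1 - 3 * s ^ 2) = 4 := by
  have h := congrArg (d⁄dX ℚ) hs
  rw [map_sub, Derivation.leibniz_pow, Derivation.leibniz, derivative_X,
    show (4 : ℚ⟦X⟧) = algebraMap ℚ _ 4 from (map_ofNat _ 4).symm, Derivation.map_algebraMap] at h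
  simp only [smul_eq_mul, nsmul_eq_mul, map_ofNat] at h
  push_cast at h
  linear_combination h

theorem derivative_derivative_trinomial (hs : s - s ^ 3 = 4 * X) :
    d⁄dX ℚ (d⁄dX ℚ s) * (1 - 3 * s ^ 2) = 6 * s * (d⁄dX ℚ s) ^ 2 := by
  have h := congrArg (d⁄dX ℚ) (derivative_trinomial hs)
  rw [Derivation.leibniz, map_sub, Derivation.leibniz, Derivation.leibniz_pow,
    show (4 : ℚ⟦X⟧) = algebraMap ℚ _ 4 from (map_ofNat _ 4).symm,
    show (3 : ℚ⟦X⟧) = algebraMap ℚ _ 3 from (map_ofNat _ 3).symm, Derivation.map_algebraMap,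
    Derivation.map_algebraMap, Derivation.map_one_eq_zero] at h
  simp only [smul_eq_mul, nsmul_eq_mul, map_ofNat] at h
  push_cast at h
  linear_combination h

theorem four_ne_zero_powerSeries : (4 : ℚ⟦X⟧) ≠ 0 := fun h => by
  have := congrArg constantCoeff h
  rw [map_ofNat, map_zero] at this
  norm_num at this

theorem one_sub_ne_zero (h0 : constantCoeff s = 1) : (1 : ℚ⟦X⟧) - 3 * s ^ 2 ≠ 0 := fun h => by
  have := congrArg constantCoeff h
  rw [map_sub, map_one, map_mul, map_pow, h0, map_zero, map_ofNat] at this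
  norm_num at this

/-- Implicit differentiation gives s' and s'' as rational functions of s with powers of 1 - 3s² as
denominators; clearing them leaves a polynomial identity modulo 4X = s - s³. The factor 1 - 108X²
is, up to the constant 4, the discriminant of the cubic. -/
theorem ode_root (hs : s - s ^ 3 = 4 * X) (h0 : constantCoeff s = 1) :
    (1 - 108 * X ^ 2) * d⁄dX ℚ (d⁄dX ℚ s) - 108 * X * d⁄dX ℚ s + 12 * s = 0 := by
  have h1 := derivative_trinomial hs
  have h2 := derivative_derivative_trinomial hs
  have hw := one_sub_ne_zero h0
  generalize d⁄dX ℚ (d⁄dX ℚ s) = s2 at *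
  generalize d⁄dX ℚ s = s1 at *
  refine (mul_eq_zero.1 (?_ : _ * (4 * (1 - 3 * s ^ 2) ^ 3) = 0)).resolve_right ?_
  · have hX : (4 : ℚ⟦X⟧) * X = s - s ^ 3 := hs.symm
    have e1 : s2 * (1 - 3 * s ^ 2) ^ 3 = 96 * s := by
      linear_combination (1 - 3 * s ^ 2) ^ 2 * h2 +
        6 * s * (s1 * (1 - 3 * s ^ 2) + 4) * h1
    have e2 : s1 * (1 - 3 * s ^ 2) ^ 3 = 4 * (1 - 3 * s ^ 2) ^ 2 := by
      linear_combination (1 - 3 * s ^ 2) ^ 2 * h1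
    linear_combination (4 - 432 * X ^ 2) * e1 - 432 * X * e2 +
      (-27 * 96 * s * (4 * X + s - s ^ 3) - 432 * (1 - 3 * s ^ 2) ^ 2) * hX
  · exact mul_ne_zero four_ne_zero_powerSeries (pow_ne_zero _ hw)

/-- The inhomogeneous term 32 = 48 · 2/3 reflects that the squares of the three roots of the cubic
average 2/3. -/
theorem ode_root_sq (hs : s - s ^ 3 = 4 * X) (h0 : constantCoeff s = 1) :
    (1 - 108 * X ^ 2) * d⁄dX ℚ (d⁄dX ℚ (s ^ 2)) - 108 * X * d⁄dX ℚ (s ^ 2) +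
      (48 * s ^ 2 - 32) = 0 := by
  have h1 := derivative_trinomial hs
  have h2 := derivative_derivative_trinomial hs
  have hw := one_sub_ne_zero h0
  have hd1 : d⁄dX ℚ (s ^ 2) = 2 * s * d⁄dX ℚ s := by
    rw [pow_two, Derivation.leibniz, smul_eq_mul]; ring
  have hd2 : d⁄dX ℚ (2 * s * d⁄dX ℚ s) = 2 * (d⁄dX ℚ s) ^ 2 + 2 * s * d⁄dX ℚ (d⁄dX ℚ s) := by
    rw [show 2 * s * d⁄dX ℚ s = s * d⁄dX ℚ s + s * d⁄dX ℚ s by ring, map_add, Derivation.leibniz,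
      smul_eq_mul, smul_eq_mul]; ring
  rw [hd1, hd2]
  generalize d⁄dX ℚ (d⁄dX ℚ s) = s2 at *
  generalize d⁄dX ℚ s = s1 at *
  refine (mul_eq_zero.1 (?_ : _ * (4 * (1 - 3 * s ^ 2) ^ 3) = 0)).resolve_right ?_
  · have hX : (4 : ℚ⟦X⟧) * X = s - s ^ 3 := hs.symm
    have e1 : s2 * (1 - 3 * s ^ 2) ^ 3 = 96 * s := by
      linear_combination (1 - 3 * s ^ 2) ^ 2 * h2 +
        6 * s * (s1 * (1 - 3 * s ^ 2) + 4) * h1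
    have e2 : s1 * (1 - 3 * s ^ 2) ^ 3 = 4 * (1 - 3 * s ^ 2) ^ 2 := by
      linear_combination (1 - 3 * s ^ 2) ^ 2 * h1
    have e3 : s1 ^ 2 * (1 - 3 * s ^ 2) ^ 3 = 16 * (1 - 3 * s ^ 2) := by
      linear_combination (1 - 3 * s ^ 2) * (s1 * (1 - 3 * s ^ 2) + 4) * h1
    linear_combination (4 - 432 * X ^ 2) * (2 * s * e1 + 2 * e3) - 432 * X * (2 * s) * e2 +
      (-27 * (192 * s ^ 2 + 32 * (1 - 3 * s ^ 2)) * (4 * X + s - s ^ 3)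
        - 864 * s * (1 - 3 * s ^ 2) ^ 2) * hX
  · exact mul_ne_zero four_ne_zero_powerSeries (pow_ne_zero _ hw)

theorem coeff_ode (f : ℚ⟦X⟧) (c : ℚ) (n : ℕ) :
    coeff n ((1 - 108 * X ^ 2) * d⁄dX ℚ (d⁄dX ℚ f) - 108 * X * d⁄dX ℚ f + C c * f) =
      (n + 2) * (n + 1) * coeff (n + 2) f - (108 * n ^ 2 - c) * coeff n f := by
  have e : (1 - 108 * X ^ 2) * d⁄dX ℚ (d⁄dX ℚ f) - 108 * X * d⁄dX ℚ f + C c * f =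
      -- X²f'' + Xf' is the square of the Euler operator X d/dX applied to f, so it multiplies the
      -- n-th coefficient by n².
      d⁄dX ℚ (d⁄dX ℚ f) - C 108 * (X ^ 2 * d⁄dX ℚ (d⁄dX ℚ f) + X * d⁄dX ℚ f) + C c * f := by
    rw [map_ofNat C 108]; ring
  rw [e, map_add, map_sub, coeff_C_mul, coeff_C_mul, map_add, pow_two, mul_assoc]
  rcases n with _ | _ | n
  · simp [coeff_derivative]; ring
  · simp [coeff_succ_X_mul, coeff_derivative]; ring
  · simp only [coeff_succ_X_mul, coeff_derivative]; push_cast; ring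

theorem coeff_root_rec (hs : s - s ^ 3 = 4 * X) (h0 : constantCoeff s = 1) (n : ℕ) :
    ((n : ℚ) + 2) * (n + 1) * coeff (n + 2) s = (108 * n ^ 2 - 12) * coeff n s := by
  have h := coeff_ode s 12 n
  rw [map_ofNat C 12, ode_root hs h0, map_zero] at h
  linarith

theorem coeff_root_sq_rec (hs : s - s ^ 3 = 4 * X) (h0 : constantCoeff s = 1) (n : ℕ) :
    ((n : ℚ) + 2) * (n + 1) * coeff (n + 2) (s ^ 2) =
      (108 * n ^ 2 - 48) * coeff n (s ^ 2) + if n = 0 then 32 else 0 := by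
  have h := coeff_ode (s ^ 2) 48 n
  have h' : (1 - 108 * X ^ 2) * d⁄dX ℚ (d⁄dX ℚ (s ^ 2)) - 108 * X * d⁄dX ℚ (s ^ 2) +
      C 48 * s ^ 2 = C (32 : ℚ) := by
    rw [map_ofNat C 48, map_ofNat C 32]
    linear_combination ode_root_sq hs h0
  rw [h', coeff_C] at h
  linarith

theorem coeff_one_root (hs : s - s ^ 3 = 4 * X) (h0 : constantCoeff s = 1) : coeff 1 s = -2 := by
  have h := congrArg constantCoeff (derivative_trinomial hs)
  rw [map_mul, map_sub, map_mul, map_pow, map_one, h0, map_ofNat, map_ofNat,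
    ← coeff_zero_eq_constantCoeff_apply, coeff_derivative] at h
  norm_num at h
  linarith

theorem coeff_one_root_sq (hs : s - s ^ 3 = 4 * X) (h0 : constantCoeff s = 1) :
    coeff 1 (s ^ 2) = -4 := by
  rw [pow_two, coeff_mul, Finset.Nat.sum_antidiagonal_eq_sum_range_succ_mk]
  simp [Finset.sum_range_succ, coeff_one_root hs h0, h0]
  norm_num

end ODE

/-! ### Generalized binomials and closed forms -/

theorem succ_mul_choose_succ (x : ℚ) (k : ℕ) :
    ((k : ℚ) + 1) * Ring.choose x (k + 1) = (x - k) * Ring.choose x k := by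
  have h := Ring.choose_smul_choose x (Nat.le_succ k)
  rw [Nat.succ_eq_add_one, Nat.choose_succ_self_right, Nat.add_sub_cancel_left,
    Ring.choose_one_right, nsmul_eq_mul] at h
  push_cast at h
  linarith

theorem succ_mul_choose_add_one_succ (x : ℚ) (k : ℕ) :
    ((k : ℚ) + 1) * Ring.choose (x + 1) (k + 1) = (x + 1) * Ring.choose x k := by
  rw [Ring.choose_succ_succ]
  linear_combination succ_mul_choose_succ x k

/-- The upper argument grows like 3k/2, so one two-step advance in `k` raises it by 3. -/
theorem choose_add_three (x : ℚ) (k : ℕ) :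
    ((k : ℚ) + 2) * (k + 1) * (x + 1 - k) * Ring.choose (x + 3) (k + 2) =
      (x + 3) * (x + 2) * (x + 1) * Ring.choose x k := by
  have h1 := succ_mul_choose_add_one_succ (x + 2) (k + 1)
  have h2 := succ_mul_choose_add_one_succ (x + 1) k
  have h3 := succ_mul_choose_add_one_succ x k
  have h4 := succ_mul_choose_succ (x + 1) k
  rw [show x + 2 + 1 = x + 3 by ring] at h1
  rw [show x + 1 + 1 = x + 2 by ring] at h2
  push_cast at h1
  linear_combination (k + 1) * (x + 1 - k) * h1 + (x + 3) * (x + 1 - k) * h2 +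
    (x + 3) * (x + 2) * (h3 - h4)

/-- The recurrence links coefficients two apart, so each parity class needs its own start: the
coefficient of X comes from s', that of X² from the recurrence at 0. -/
theorem coeff_root {s : ℚ⟦X⟧} (hs : s - s ^ 3 = 4 * X) (h0 : constantCoeff s = 1) (k : ℕ) :
    coeff (k + 1) s = -(4 ^ (k + 1) / (2 * (k + 1))) * Ring.choose (3 * (k : ℚ) / 2) k := by
  induction k using Nat.twoStepInduction with
  | zero => rw [zero_add, coeff_one_root hs h0, Ring.choose_zero_right]; norm_num
  | one =>
    have h := coeff_root_rec hs h0 0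
    rw [coeff_zero_eq_constantCoeff_apply, h0] at h
    norm_num at h
    rw [Ring.choose_one_right]
    norm_num
    linarith
  | more k ih _ =>
    have h := coeff_root_rec hs h0 (k + 1)
    have hc := choose_add_three (3 * (k : ℚ) / 2) k
    rw [ih] at h
    push_cast at h ⊢
    rw [show 3 * ((k : ℚ) + 2) / 2 = 3 * k / 2 + 3 by ring]
    generalize Ring.choose (3 * (k : ℚ) / 2 + 3) (k + 2) = B at *
    generalize Ring.choose (3 * (k : ℚ) / 2) k = A at *
    change coeff (k + 1 + 2) s = _
    generalize coeff (k + 1 + 2) s = D at *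
    -- For x = 3k/2, the factor x + 1 - k in `choose_add_three` is (k + 2)/2.
    have hB : B = 2 * ((3 * (k : ℚ) / 2 + 3) * (3 * k / 2 + 2) * (3 * k / 2 + 1)) * A / ((k + 2) * (k + 1) * (k + 2)) := by
      rw [eq_div_iff (by positivity)]
      linear_combination 2 * hc
    have hD : D = (108 * ((k : ℚ) + 1) ^ 2 - 12) * (-(4 ^ (k + 1) / (2 * (k + 1))) * A) /
        ((k + 1 + 2) * (k + 1 + 1)) := by
      rw [eq_div_iff (by positivity)]
      linear_combination h
    rw [hB, hD]
    field_simp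
    ring

theorem coeff_root_sq {s : ℚ⟦X⟧} (hs : s - s ^ 3 = 4 * X) (h0 : constantCoeff s = 1) (k : ℕ) :
    coeff (k + 1) (s ^ 2) =
      -(4 ^ (k + 1) / (k + 1)) * Ring.choose (3 * (k : ℚ) / 2 - 1 / 2) k := by
  induction k using Nat.twoStepInduction with
  | zero => rw [zero_add, coeff_one_root_sq hs h0, Ring.choose_zero_right]; norm_num
  | one =>
    have h := coeff_root_sq_rec hs h0 0
    rw [coeff_zero_eq_constantCoeff_apply, map_pow constantCoeff, h0] at h
    norm_num at h
    rw [Ring.choose_one_right]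
    norm_num
    linarith
  | more k ih _ =>
    have h := coeff_root_sq_rec hs h0 (k + 1)
    have hc := choose_add_three (3 * (k : ℚ) / 2 - 1 / 2) k
    rw [ih, if_neg (Nat.succ_ne_zero k), add_zero] at h
    push_cast at h ⊢
    rw [show 3 * ((k : ℚ) + 2) / 2 - 1 / 2 = 3 * k / 2 - 1 / 2 + 3 by ring]
    generalize Ring.choose (3 * (k : ℚ) / 2 - 1 / 2 + 3) (k + 2) = B at *
    generalize Ring.choose (3 * (k : ℚ) / 2 - 1 / 2) k = A at *
    change coeff (k + 1 + 2) (s ^ 2) = _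
    generalize coeff (k + 1 + 2) (s ^ 2) = D at *
    -- Now x = 3k/2 - 1/2, so x + 1 - k is (k + 1)/2.
    have hB : B = 2 * ((3 * (k : ℚ) / 2 + 5 / 2) * (3 * k / 2 + 3 / 2) * (3 * k / 2 + 1 / 2)) * A / ((k + 2) * (k + 1) * (k + 1)) := by
      rw [eq_div_iff (by positivity)]
      linear_combination 2 * hc
    have hD : D = (108 * ((k : ℚ) + 1) ^ 2 - 48) * (-(4 ^ (k + 1) / ((k + 1))) * A) /
        ((k + 1 + 2) * (k + 1 + 1)) := by
      rw [eq_div_iff (by positivity)]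
      linear_combination h
    rw [hB, hD]
    field_simp
    ring

end NoncrossingGraph

open NoncrossingGraph

theorem mainTheorem4 (n : ℕ) (hn : 1 ≤ n) :
    (numConnectedNoncrossing n : ℚ) =
      (2 : ℚ) ^ (2 * n - 1) / (n : ℚ) * Ring.choose (3 * (n : ℚ) / 2 - 2) (n - 1) -
        (2 : ℚ) ^ (2 * n - 2) / (n : ℚ) * Ring.choose (3 * (n : ℚ) / 2 - 3 / 2) (n - 1) := by
  obtain ⟨k, rfl⟩ := Nat.exists_eq_add_of_le' hn
  -- The coefficient of X^(k+1) in 2XC is 2N_{k+1}; the term -s² gives the first binomial and s the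
  -- second.
  have h := congrArg (PowerSeries.coeff (k + 1)) trinomialRoot_sub_sq
  rw [map_sub, coeff_root trinomialRoot_eq constantCoeff_trinomialRoot,
    coeff_root_sq trinomialRoot_eq constantCoeff_trinomialRoot,
    show (2 : PowerSeries ℚ) = PowerSeries.C (2 : ℚ) from (map_ofNat PowerSeries.C 2).symm,
    PowerSeries.coeff_C_mul, PowerSeries.coeff_succ_X_mul, connGF, PowerSeries.coeff_mk] at h
  have h4 : (4 : ℚ) ^ (k + 1) = 4 * 2 ^ (2 * k) := by rw [pow_succ, pow_mul]; norm_num; ring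
  rw [show 2 * (k + 1) - 1 = 2 * k + 1 by omega, show 2 * (k + 1) - 2 = 2 * k by omega,
    Nat.add_sub_cancel]
  push_cast
  rw [show 3 * ((k : ℚ) + 1) / 2 - 2 = 3 * k / 2 - 1 / 2 by ring,
    show 3 * ((k : ℚ) + 1) / 2 - 3 / 2 = 3 * k / 2 by ring]
  rw [h4] at h
  have hk : (k : ℚ) + 1 ≠ 0 := by positivity
  field_simp at h ⊢
  linear_combination -h / 4
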